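/- Let $d,T\ge 1$ be integers. Write $x=(x_1,\dots,x_T)\in\mathbb R^{dT}$ with $x_t\in\mathbb R^d$ and $x_{1:t}=(x_1,\dots,x_t)\in\mathbb R^{dt}$, equip $\mathbb R^d$ with the Euclidean norm and $\mathbb R^{dt}$ with the sum-norm $\|x_{1:t}\|=\sum_{s=1}^t\|x_s\|$. Let $\mathcal P_1(\mathbb R^{dT})$ be the set of Borel probability measures $\mu$ on $\mathbb R^{dT}$ with $\int\|x\|\,\mu(dx)<\infty$. For $1\le t\le T-1$ let $\mu_{1:t}$ be the law of $x_{1:t}$ under $\mu$ and $\mu_{x_{1:t}}$ the regular conditional law under $\mu$ of $x_{t+1}$ given $x_{1:t}$; for a probability measure $\pi$ on $\mathbb R^{dT}\times\mathbb R^{dT}$ let $\pi_{1:t}$ be the law of $(x_{1:t},y_{1:t})$ and $\pi_{x_{1:t},y_{1:t}}$ the regular conditional law of $(x_{t+1},y_{t+1})$ given $(x_{1:t},y_{1:t})$. For $\alpha>0$, $\mu$ has *$\alpha$-linear conditional moments* if for all $t=1,\dots,T-1$ and $\mu_{1:t}$-almost every $x_{1:t}$, $$\int\|x_{t+1}\|\,\mu_{x_{1:t}}(dx_{t+1})\le\alpha(\|x_{1:t}\|+1)$$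 (equivalently, for each $t$ some version of the conditional law satisfies this for all $x_{1:t}\in\mathbb R^{dt}$). Let $\mathrm{Cpl}(\mu,\nu)$ be the set of probability measures with first marginal $\mu$ and second marginal $\nu$, and let $\mathrm{Cpl}_{\mathrm{bc}}(\mu,\nu)$ be the set of bi-causal couplings, i.e. of those $\pi\in\mathrm{Cpl}(\mu,\nu)$ such that for all $t=1,\dots,T-1$, $\pi_{x_{1:t},y_{1:t}}\in\mathrm{Cpl}(\mu_{x_{1:t}},\nu_{y_{1:t}})$ for $\pi_{1:t}$-almost every $(x_{1:t},y_{1:t})$. Define $$\mathcal{AW}_1(\mu,\nu)=\inf_{\pi\in\mathrm{Cpl}_{\mathrm{bc}}(\mu,\nu)}\int\|x-y\|\,\pi(dx,dy),\qquad \mathrm{TV}_1(\mu,\nu)=\int\Big(\|x\|+\tfrac12\Big)\,|\mu-\nu|(dx),$$ where $|\mu-\nu|$ is the total variation measure of the signed measure $\mu-\nu$. **Theorem.** Let $\alpha>0$ and let $\mu,\nu\in\mathcal P_1(\mathbb R^{dT})$ have $\alpha$-linear conditional moments. Then $$\mathcal{AW}_1(\mu,\nu)\le\big((3+4\alpha)^T-1\big)\,\mathrm{TV}_1(\mu,\nu).$$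 -/

import Mathlib

open MeasureTheory ProbabilityTheory
open scoped ENNReal

namespace AdaptedTransport

/-- Paths `x = (x_1, …, x_t)` with values in the Euclidean space `ℝ^d`. The coordinate `x_{s+1}`
of the mathematics is `x s`, with `s = 0, …, t - 1`. The measurable structure is the Borel one. -/
abbrev PathSpace (d t : ℕ) : Type := Fin t → EuclideanSpace ℝ (Fin d)

/-- The sum-norm `‖x‖ = ∑ s, ‖x_s‖` on path space, with the Euclidean norm on `ℝ^d`
(the instance norm of a function type is the sup norm, and is not used). -/
noncomputable def pathNorm {d t : ℕ} (x : PathSpace d t) : ℝ := ∑ s, ‖x s‖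

/-- The initial segment `x_{1:t}` of a path `x = x_{1:T}`. -/
def upTo {d t T : ℕ} (h : t ≤ T) (x : PathSpace d T) : PathSpace d t :=
  fun s => x (Fin.castLE h s)

/-- The value `x_{t+1}` of a path `x = x_{1:T}`, for `t < T`. -/
def next {d t T : ℕ} (h : t < T) (x : PathSpace d T) : EuclideanSpace ℝ (Fin d) := x ⟨t, h⟩

/-- Finite first moment: a probability measure with this property is an element of
`𝒫_1(ℝ^{dT})`. -/
def HasFiniteFirstMoment {d T : ℕ} (μ : Measure (PathSpace d T)) : Prop :=
  ∫⁻ x, ENNReal.ofReal (pathNorm x) ∂μ < ∞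

/-- The kernel `x_{1:t} ↦ μ_{x_{1:t}}`: the regular conditional law under `μ` of `x_{t+1}`
given `x_{1:t}`. -/
noncomputable def stepKernel {d t T : ℕ} (h : t < T) (μ : Measure (PathSpace d T))
    [IsFiniteMeasure μ] : Kernel (PathSpace d t) (EuclideanSpace ℝ (Fin d)) :=
  condDistrib (next h) (upTo h.le) μ

/-- The kernel `(x_{1:t}, y_{1:t}) ↦ π_{x_{1:t}, y_{1:t}}`: the regular conditional law under `π`
of `(x_{t+1}, y_{t+1})` given `(x_{1:t}, y_{1:t})`. -/
noncomputable def jointStepKernel {d t T : ℕ} (h : t < T)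
    (π : Measure (PathSpace d T × PathSpace d T)) [IsFiniteMeasure π] :
    Kernel (PathSpace d t × PathSpace d t)
      (EuclideanSpace ℝ (Fin d) × EuclideanSpace ℝ (Fin d)) :=
  condDistrib (fun q => (next h q.1, next h q.2)) (fun q => (upTo h.le q.1, upTo h.le q.2)) π

/-- `μ` has `α`-linear conditional moments: for `t = 1, …, T - 1`,
`∫ ‖x_{t+1}‖ dμ_{x_{1:t}} ≤ α (‖x_{1:t}‖ + 1)`.
Regular conditional laws are determined only up to null sets of the marginal `μ_{1:t}`, so the
bound is asked for `μ_{1:t}`-almost every `x_{1:t}`; equivalently, some version of the conditional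
law satisfies it at every `x_{1:t}`. -/
def HasLinearConditionalMoments {d T : ℕ} (α : ℝ) (μ : Measure (PathSpace d T))
    [IsFiniteMeasure μ] : Prop :=
  ∀ (t : ℕ) (_ : 1 ≤ t) (h : t < T), ∀ᵐ x ∂(μ.map (upTo h.le)),
    ∫⁻ z, ENNReal.ofReal ‖z‖ ∂(stepKernel h μ x) ≤ ENNReal.ofReal (α * (pathNorm x + 1))

/-- `π ∈ Cpl(μ, ν)`. -/
def IsCoupling {X Y : Type*} [MeasurableSpace X] [MeasurableSpace Y]
    (π : Measure (X × Y)) (μ : Measure X) (ν : Measure Y) : Prop :=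
  π.fst = μ ∧ π.snd = ν

/-- `π ∈ Cpl_bc(μ, ν)`: `π` is a coupling of `μ` and `ν`, and for `t = 1, …, T - 1` its conditional
law satisfies `π_{x_{1:t}, y_{1:t}} ∈ Cpl(μ_{x_{1:t}}, ν_{y_{1:t}})`, for `π_{1:t}`-almost every
`(x_{1:t}, y_{1:t})`. -/
def IsBicausalCoupling {d T : ℕ} (π : Measure (PathSpace d T × PathSpace d T)) [IsFiniteMeasure π]
    (μ ν : Measure (PathSpace d T)) [IsFiniteMeasure μ] [IsFiniteMeasure ν] : Prop :=
  IsCoupling π μ ν ∧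
    ∀ (t : ℕ) (_ : 1 ≤ t) (h : t < T),
      ∀ᵐ p ∂(π.map fun q => (upTo h.le q.1, upTo h.le q.2)),
        IsCoupling (jointStepKernel h π p) (stepKernel h μ p.1) (stepKernel h ν p.2)

/-- The adapted Wasserstein distance
`AW_1(μ, ν) = inf { ∫ ‖x - y‖ π(dx, dy) | π ∈ Cpl_bc(μ, ν) }`, as an extended nonnegative
number. -/
noncomputable def AW1 {d T : ℕ} (μ ν : Measure (PathSpace d T)) [IsFiniteMeasure μ]
    [IsFiniteMeasure ν] : ℝ≥0∞ :=
  ⨅ (π : ProbabilityMeasure (PathSpace d T × PathSpace d T))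
    (_ : IsBicausalCoupling (π : Measure (PathSpace d T × PathSpace d T)) μ ν),
    ∫⁻ q, ENNReal.ofReal (pathNorm (q.1 - q.2)) ∂(π : Measure (PathSpace d T × PathSpace d T))

/-- The weighted total variation distance `TV_1(μ, ν) = ∫ (‖x‖ + 1/2) |μ - ν|(dx)`, where
`|μ - ν| = (μ - ν)⁺ + (μ - ν)⁻` is the total variation measure of the signed measure `μ - ν`;
it is an extended nonnegative number. -/
noncomputable def TV1 {d T : ℕ} (μ ν : Measure (PathSpace d T)) [IsFiniteMeasure μ]
    [IsFiniteMeasure ν] : ℝ≥0∞ :=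
  ∫⁻ x, ENNReal.ofReal (pathNorm x + 1 / 2)
    ∂(μ.toSignedMeasure - ν.toSignedMeasure).totalVariation

end AdaptedTransport

/-! The bound comes from an explicit bi-causal coupling, built one time step at a time. While the
two paths agree, the next step uses the coupling of the conditional laws that leaves their common
part on the diagonal; once they differ, the product coupling is used. A kernel family whose values
couple the conditional laws always yields a bi-causal coupling (`isBicausalCoupling_jointLaw`).

With `w = ‖x‖ + 1/2`, the cost satisfies `‖x - y‖ ≤ 1_{x ≠ y} (w x + w y)`, so it suffices to
control the expectation `a_t` of the right-hand side at time `t`. Mass that is already off the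
diagonal contributes at most `(1 + 2α) a_t` at the next step, by the moment condition. Let `D` be
the law of the prefix on the diagonal. Fresh separation is governed by the positive and negative
parts of `D ⊗ κ - D ⊗ η`, where `κ`, `η` are the conditional laws. By minimality of the Jordan
decomposition these parts are dominated by the Jordan parts of `μ - ν` together with the flow out of
the off-diagonal mass, which costs another `(1 + 2α) a_t` (`offDiagCost_compProd_le`). Hence
`a_{t+1} ≤ (2 + 4α) a_t + TV_1` with `a_0 = 0`, and the constant follows by induction
(`offDiagCost_jointLaw_le`). -/

namespace AdaptedTransport

/-! ### Diagonal-optimal coupling kernels and the one-step cost estimate. -/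

section Kernels

variable {X E : Type*} [MeasurableSpace X] [MeasurableSpace E]

/-- Common part and mutually singular remainders of two finite kernels, with a jointly measurable
Hahn set. -/
theorem exists_kernel_hahn [MeasurableSpace.CountableOrCountablyGenerated X E]
    (κ η : Kernel X E) [IsFiniteKernel κ] [IsFiniteKernel η] :
    ∃ m P Q : Kernel X E, IsFiniteKernel m ∧ IsFiniteKernel P ∧ IsFiniteKernel Q ∧
      κ = m + P ∧ η = m + Q ∧ ∃ G : Set (X × E), MeasurableSet G ∧
        ∀ x, P x {z | (x, z) ∉ G} = 0 ∧ Q x {z | (x, z) ∈ G} = 0 := by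
  -- `g` is the density of `κ` with respect to `κ + η`, and `1 - g` that of `η`. The truncation
  -- makes `g ≤ 1` hold everywhere instead of almost everywhere. The common part gets density `min g
  -- (1 - g)`, the remainders `(2g - 1)⁺` and `(1 - 2g)⁺`, and the Hahn set is `{g > 1/2}`.
  set g : X → E → ℝ := fun x z => min (Kernel.rnDerivAux κ (κ + η) x z) 1 with hg
  have hgm : Measurable (fun p : X × E => g p.1 p.2) :=
    (Kernel.measurable_rnDerivAux _ _).min measurable_const
  have hle : κ ≤ κ + η := fun x => Measure.le_add_right le_rfl
  have hg0 : ∀ x z, 0 ≤ g x z := fun x z => le_min (Kernel.rnDerivAux_nonneg hle) zero_le_one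
  have hg1 : ∀ x z, g x z ≤ 1 := fun x z => min_le_right _ _
  have hae : ∀ x, Kernel.rnDerivAux κ (κ + η) x =ᵐ[(κ + η) x] g x := fun x =>
    (Kernel.rnDerivAux_le_one hle).mono fun z hz => (min_eq_left hz).symm
  have hκ : Kernel.withDensity (κ + η) (fun x z => ENNReal.ofReal (g x z)) = κ := by
    refine Eq.trans ?_ (Kernel.withDensity_rnDerivAux κ η)
    refine Kernel.withDensity_congr_ae _ (by exact hgm.ennreal_ofReal)
      (by exact (Kernel.measurable_rnDerivAux _ _).ennreal_ofReal) fun x => ?_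
    filter_upwards [hae x] with z hz
    rw [← hz, ENNReal.ofReal]
  have hη : Kernel.withDensity (κ + η) (fun x z => ENNReal.ofReal (1 - g x z)) = η := by
    refine Eq.trans ?_ (Kernel.withDensity_one_sub_rnDerivAux κ η)
    refine Kernel.withDensity_congr_ae _ (by exact (measurable_const.sub hgm).ennreal_ofReal)
      (by exact (measurable_const.sub (Kernel.measurable_rnDerivAux _ _)).ennreal_ofReal)
      fun x => ?_
    filter_upwards [hae x] with z hz
    rw [← hz, ENNReal.ofReal]
  have key : ∀ f : X → E → ℝ, (∀ x z, f x z ≤ 1) →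
      IsFiniteKernel (Kernel.withDensity (κ + η) fun x z => ENNReal.ofReal (f x z)) := by
    intro f h1
    refine Kernel.isFiniteKernel_withDensity_of_bounded _ (B := 1) (by simp) fun x z => ?_
    simpa using h1 x z
  have hadd : ∀ f₁ f₂ : X → E → ℝ, Measurable (fun p : X × E => f₁ p.1 p.2) →
      Measurable (fun p : X × E => f₂ p.1 p.2) →
      (Kernel.withDensity (κ + η) fun x z => ENNReal.ofReal (f₁ x z)) +
        (Kernel.withDensity (κ + η) fun x z => ENNReal.ofReal (f₂ x z)) =
      Kernel.withDensity (κ + η) fun x z => ENNReal.ofReal (f₁ x z) + ENNReal.ofReal (f₂ x z) := by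
    intro f₁ f₂ h₁ h₂
    rw [← Kernel.withDensity_add_right]
    · rfl
    · exact h₁.ennreal_ofReal
    · exact h₂.ennreal_ofReal
  have hm1 : Measurable (fun p : X × E => min (g p.1 p.2) (1 - g p.1 p.2)) :=
    hgm.min (measurable_const.sub hgm)
  have hm2 : Measurable (fun p : X × E => 2 * g p.1 p.2 - 1) :=
    (hgm.const_mul 2).sub measurable_const
  have hm3 : Measurable (fun p : X × E => 1 - 2 * g p.1 p.2) :=
    measurable_const.sub (hgm.const_mul 2)
  refine ⟨Kernel.withDensity (κ + η) fun x z => ENNReal.ofReal (min (g x z) (1 - g x z)),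
    Kernel.withDensity (κ + η) fun x z => ENNReal.ofReal (2 * g x z - 1),
    Kernel.withDensity (κ + η) fun x z => ENNReal.ofReal (1 - 2 * g x z),
    key _ fun x z => (min_le_left _ _).trans (hg1 x z),
    key _ fun x z => by linarith [hg1 x z], key _ fun x z => by linarith [hg0 x z],
    ?_, ?_, {p | 1 / 2 < g p.1 p.2}, measurableSet_lt measurable_const hgm, fun x => ⟨?_, ?_⟩⟩
  · rw [hadd _ _ hm1 hm2]
    conv_lhs => rw [← hκ]
    congr 1
    ext x z
    rcases le_total (g x z) (1 - g x z) with h | h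
    · rw [min_eq_left h, ENNReal.ofReal_of_nonpos (by linarith : 2 * g x z - 1 ≤ 0), add_zero]
    · rw [min_eq_right h, ← ENNReal.ofReal_add (by linarith [hg1 x z]) (by linarith)]
      congr 1; ring
  · rw [hadd _ _ hm1 hm3]
    conv_lhs => rw [← hη]
    congr 1
    ext x z
    rcases le_total (g x z) (1 - g x z) with h | h
    · rw [min_eq_left h, ← ENNReal.ofReal_add (hg0 x z) (by linarith)]
      congr 1; ring
    · rw [min_eq_right h, ENNReal.ofReal_of_nonpos (by linarith : 1 - 2 * g x z ≤ 0), add_zero]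
  · rw [Kernel.withDensity_apply' _ hm2.ennreal_ofReal]
    refine (setLIntegral_congr_fun (measurableSet_lt measurable_const
      (hgm.comp measurable_prodMk_left)).compl fun z hz => ?_).trans lintegral_zero
    have : ¬ (1 / 2 < g x z) := hz
    exact ENNReal.ofReal_of_nonpos (by linarith)
  · rw [Kernel.withDensity_apply' _ hm3.ennreal_ofReal]
    refine (setLIntegral_congr_fun (measurableSet_lt measurable_const
      (hgm.comp measurable_prodMk_left)) fun z hz => ?_).trans lintegral_zero
    have : 1 / 2 < g x z := hz
    exact ENNReal.ofReal_of_nonpos (by linarith)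

/-- Minimality of the positive part of a kernel difference, integrated against a measure. -/
theorem compProd_le_of_hahn {m P Q : Kernel X E} [IsFiniteKernel m] [IsFiniteKernel P]
    [IsFiniteKernel Q] {G : Set (X × E)} (hG : MeasurableSet G)
    (hP : ∀ x, P x {z | (x, z) ∉ G} = 0) (hQ : ∀ x, Q x {z | (x, z) ∈ G} = 0)
    (D : Measure X) [IsFiniteMeasure D] {ρ : Measure (X × E)}
    (h : D ⊗ₘ (m + P) ≤ D ⊗ₘ (m + Q) + ρ) : D ⊗ₘ P ≤ ρ := by
  refine Measure.le_intro fun S hS _ => ?_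
  have hPG : (D ⊗ₘ P) Gᶜ = 0 := by
    rw [Measure.compProd_apply hG.compl]
    exact (lintegral_congr fun x => hP x).trans lintegral_zero
  have hQG : (D ⊗ₘ Q) G = 0 := by
    rw [Measure.compProd_apply hG]
    exact (lintegral_congr fun x => hQ x).trans lintegral_zero
  -- On `G` the `Q`-part vanishes and the finite common part cancels, which leaves `P` against `ρ`;
  -- outside `G` there is no `P`-mass.
  have h1 := h (S ∩ G)
  rw [Measure.compProd_add_right, Measure.compProd_add_right, Measure.add_apply,
    Measure.add_apply, Measure.add_apply, measure_mono_null Set.inter_subset_right hQG,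
    add_zero, ENNReal.add_le_add_iff_left (measure_ne_top _ _)] at h1
  calc (D ⊗ₘ P) S ≤ (D ⊗ₘ P) (S ∩ G) + (D ⊗ₘ P) Gᶜ := by
        refine (measure_mono fun p hp => ?_).trans (measure_union_le _ _)
        by_cases hpG : p ∈ G
        · exact Or.inl ⟨hp, hpG⟩
        · exact Or.inr hpG
    _ ≤ ρ S := by
        rw [hPG, add_zero]
        exact h1.trans (measure_mono Set.inter_subset_left)

/-- The kernel with values `(P x univ)⁻¹ • (P x).prod (Q x)`. -/
noncomputable def normalizedProd (P Q : Kernel X E) [IsFiniteKernel P] [IsFiniteKernel Q] :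
    Kernel X (E × E) where
  toFun x := (P x Set.univ)⁻¹ • (P ×ₖ Q) x
  measurable' := by
    refine Measure.measurable_of_measurable_coe _ fun s hs => ?_
    simp only [Measure.smul_apply, smul_eq_mul]
    exact (P.measurable_coe MeasurableSet.univ).inv.mul (Kernel.measurable_coe _ hs)

theorem normalizedProd_apply (P Q : Kernel X E) [IsFiniteKernel P] [IsFiniteKernel Q] (x : X) :
    normalizedProd P Q x = (P x Set.univ)⁻¹ • (P x).prod (Q x) := by
  rw [← Kernel.prod_apply]; rfl

theorem fst_normalizedProd (P Q : Kernel X E) [IsFiniteKernel P] [IsFiniteKernel Q] {x : X}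
    (h : P x Set.univ = Q x Set.univ) : (normalizedProd P Q x).map Prod.fst = P x := by
  rw [normalizedProd_apply, Measure.map_smul, Measure.map_fst_prod, ← h, smul_smul]
  by_cases h0 : P x Set.univ = 0
  · rw [Measure.measure_univ_eq_zero.mp h0]; simp
  · rw [ENNReal.inv_mul_cancel h0 (measure_ne_top _ _), one_smul]

theorem snd_normalizedProd (P Q : Kernel X E) [IsFiniteKernel P] [IsFiniteKernel Q] {x : X}
    (h : P x Set.univ = Q x Set.univ) : (normalizedProd P Q x).map Prod.snd = Q x := by
  rw [normalizedProd_apply, Measure.map_smul, Measure.map_snd_prod, smul_smul]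
  by_cases h0 : P x Set.univ = 0
  · rw [Measure.measure_univ_eq_zero.mp (h.symm.trans h0)]; simp
  · rw [ENNReal.inv_mul_cancel h0 (measure_ne_top _ _), one_smul]

/-- The off-diagonal mass of `C (x, x)` is carried by the part of `κ x` and of `η x` that the two
laws do not share, also after integration in `x`. -/
def IsDiagOptimal (C : Kernel (X × X) (E × E)) (κ η : Kernel X E) : Prop :=
  ∃ P Q : Kernel X E, IsFiniteKernel P ∧ IsFiniteKernel Q ∧
    (∀ x, ((C (x, x)).restrict {q | q.1 ≠ q.2}).map Prod.fst ≤ P x) ∧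
    (∀ x, ((C (x, x)).restrict {q | q.1 ≠ q.2}).map Prod.snd ≤ Q x) ∧
    ∀ (D : Measure X) (ρ : Measure (X × E)), IsFiniteMeasure D →
      (D ⊗ₘ κ ≤ D ⊗ₘ η + ρ → D ⊗ₘ P ≤ ρ) ∧ (D ⊗ₘ η ≤ D ⊗ₘ κ + ρ → D ⊗ₘ Q ≤ ρ)

/-- A measurable family of couplings of `κ x` and `η y` which, for `x = y`, moves only the
mass that `κ x` and `η x` do not share. -/
theorem exists_coupling_kernel [MeasurableEq X] [MeasurableEq E]
    [MeasurableSpace.CountableOrCountablyGenerated X E]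
    (κ η : Kernel X E) [IsMarkovKernel κ] [IsMarkovKernel η] :
    ∃ C : Kernel (X × X) (E × E), IsMarkovKernel C ∧
      (∀ p, IsCoupling (C p) (κ p.1) (η p.2)) ∧
      IsDiagOptimal C κ η := by
  obtain ⟨m, P, Q, hm, hP, hQ, hκ, hη, G, hG, hPQ⟩ := exists_kernel_hahn κ η
  have hdX : MeasurableSet {p : X × X | p.1 = p.2} := measurableSet_diagonal
  have hdE : MeasurableSet {q : E × E | q.1 = q.2} := measurableSet_diagonal
  have hdiag : Measurable fun z : E => (z, z) := by fun_prop
  set S : Kernel X (E × E) := m.map (fun z => (z, z)) + normalizedProd P Q with hS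
  set R : Kernel (X × X) (E × E) :=
    (κ.comap Prod.fst measurable_fst) ×ₖ (η.comap Prod.snd measurable_snd) with hR
  classical
  set C : Kernel (X × X) (E × E) :=
    Kernel.piecewise hdX (S.comap Prod.fst measurable_fst) R with hC
  -- Both laws are probabilities sharing `m x`, so the remainders have equal mass; this is what
  -- makes the normalized product a coupling of them.
  have huniv : ∀ x, P x Set.univ = Q x Set.univ := fun x => by
    have h1 : κ x Set.univ = 1 := measure_univ
    have h2 : η x Set.univ = 1 := measure_univ
    rw [hκ, add_apply, Measure.add_apply] at h1
    rw [hη, add_apply, Measure.add_apply, ← h1,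
      ENNReal.add_right_inj (measure_ne_top _ _)] at h2
    exact h2.symm
  have hSx : ∀ x, S x = (m x).map (fun z => (z, z)) + normalizedProd P Q x := fun x => by
    rw [hS, add_apply, Kernel.map_apply _ hdiag]
  have hCd : ∀ x, C (x, x) = S x := fun x => by
    rw [hC, Kernel.piecewise_apply, if_pos (by simp), Kernel.comap_apply]
  have hcpl : ∀ p, IsCoupling (C p) (κ p.1) (η p.2) := by
    rintro ⟨x, y⟩
    by_cases hxy : x = y
    · subst hxy
      rw [hCd, hSx]
      constructor
      · rw [Measure.fst, Measure.map_add _ _ measurable_fst, Measure.map_map measurable_fst hdiag,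
          fst_normalizedProd _ _ (huniv x), hκ, add_apply]
        congr 1
        exact Measure.map_id
      · rw [Measure.snd, Measure.map_add _ _ measurable_snd, Measure.map_map measurable_snd hdiag,
          snd_normalizedProd _ _ (huniv x), hη, add_apply]
        congr 1
        exact Measure.map_id
    · rw [hC, Kernel.piecewise_apply, if_neg (by simpa using hxy), hR, Kernel.prod_apply,
        Kernel.comap_apply, Kernel.comap_apply]
      exact ⟨Measure.fst_prod, Measure.snd_prod⟩
  have hmd : ∀ x, ((m x).map (fun z => (z, z))).restrict {q : E × E | q.1 ≠ q.2} = 0 := fun x => by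
    rw [Measure.restrict_eq_zero]
    exact (Measure.map_apply hdiag hdE.compl).trans (by simp)
  refine ⟨C, ⟨fun p => ⟨?_⟩⟩, hcpl, P, Q, hP, hQ, fun x => ?_, fun x => ?_, fun D ρ hD => ?_⟩
  · rw [← Measure.fst_univ, (hcpl p).1, measure_univ]
  · rw [hCd, hSx, Measure.restrict_add, hmd, zero_add]
    exact (Measure.map_mono Measure.restrict_le_self measurable_fst).trans
      (fst_normalizedProd _ _ (huniv x)).le
  · rw [hCd, hSx, Measure.restrict_add, hmd, zero_add]
    exact (Measure.map_mono Measure.restrict_le_self measurable_snd).trans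
      (snd_normalizedProd _ _ (huniv x)).le
  · constructor
    · intro h
      rw [hκ, hη] at h
      exact compProd_le_of_hahn hG (fun x => (hPQ x).1) (fun x => (hPQ x).2) D h
    · intro h
      rw [hκ, hη] at h
      refine compProd_le_of_hahn hG.compl (fun x => ?_) (fun x => (hPQ x).1) D h
      simpa using (hPQ x).2

/-- The cost `∫_{x ≠ y} (w x + w y) π(dx, dy)`. -/
noncomputable def offDiagCost (w : X → ℝ≥0∞) (π : Measure (X × X)) : ℝ≥0∞ :=
  ∫⁻ p in {p | p.1 ≠ p.2}, (w p.1 + w p.2) ∂π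

/-- The factor `2 (1 + c)` counts the off-diagonal mass of `π` twice: once for pairs that already
differ, and once because the marginals of that mass can hide part of the discrepancy between `κ` and
`η` on the diagonal. The measures `ρ`, `σ` need not be mutually singular. The moment bounds are
asked only off the diagonal, so they are vacuous when the paths are still empty. -/
theorem offDiagCost_compProd_le [MeasurableEq X] [MeasurableEq E]
    {κ η : Kernel X E} [IsMarkovKernel κ] [IsMarkovKernel η]
    {C : Kernel (X × X) (E × E)} [IsMarkovKernel C]
    (hC : ∀ p, IsCoupling (C p) (κ p.1) (η p.2)) (hopt : IsDiagOptimal C κ η)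
    (π : Measure (X × X)) [IsFiniteMeasure π] {ρ σ : Measure (X × E)}
    (hρσ : π.fst ⊗ₘ κ + σ = π.snd ⊗ₘ η + ρ)
    {w : X → ℝ≥0∞} {v : E → ℝ≥0∞} (hw : Measurable w) (hv : Measurable v) {c : ℝ≥0∞}
    (hκc : ∀ᵐ p ∂π.restrict {p | p.1 ≠ p.2}, ∫⁻ z, v z ∂κ p.1 ≤ c * w p.1)
    (hηc : ∀ᵐ p ∂π.restrict {p | p.1 ≠ p.2}, ∫⁻ z, v z ∂η p.2 ≤ c * w p.2) :
    ∫⁻ r in {r | ¬ (r.1.1 = r.1.2 ∧ r.2.1 = r.2.2)},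
        (w r.1.1 + v r.2.1 + (w r.1.2 + v r.2.2)) ∂(π ⊗ₘ C) ≤
      2 * (1 + c) * offDiagCost w π +
        (∫⁻ q, (w q.1 + v q.2) ∂ρ + ∫⁻ q, (w q.1 + v q.2) ∂σ) := by
  obtain ⟨P, Q, hP, hQ, hPC, hQC, hmin⟩ := hopt
  have hdX : MeasurableSet {p : X × X | p.1 = p.2} := measurableSet_diagonal
  have hdE : MeasurableSet {q : E × E | q.1 = q.2} := measurableSet_diagonal
  have hW : Measurable fun q : X × E => w q.1 + v q.2 := by fun_prop
  have hWm : ∀ (K : Kernel X E) [IsFiniteKernel K],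
      Measurable fun x => ∫⁻ z, (w x + v z) ∂K x := fun K _ => hW.lintegral_kernel_prod_right'
  have hbad : MeasurableSet {r : (X × X) × (E × E) | ¬ (r.1.1 = r.1.2 ∧ r.2.1 = r.2.2)} :=
    ((measurable_fst hdX).inter (measurable_snd hdE)).compl
  set D := (π.restrict {p | p.1 = p.2}).map Prod.fst with hD
  set A := (π.restrict {p | p.1 ≠ p.2}).map Prod.fst with hA
  set B := (π.restrict {p | p.1 ≠ p.2}).map Prod.snd with hB
  have hsplit : π.restrict {p | p.1 = p.2} + π.restrict {p | p.1 ≠ p.2} = π :=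
    Measure.restrict_add_restrict_compl hdX
  have hfst : π.fst = D + A := by
    rw [hD, hA, ← Measure.map_add _ _ measurable_fst, hsplit, Measure.fst]
  -- On the diagonal both projections agree, so the same `D` occurs in both marginals of `π`.
  have hD' : D = (π.restrict {p | p.1 = p.2}).map Prod.snd :=
    Measure.map_congr (ae_restrict_of_forall_mem hdX fun p hp => hp)
  have hsnd : π.snd = D + B := by
    rw [hD', hB, ← Measure.map_add _ _ measurable_snd, hsplit, Measure.snd]
  rw [hfst, hsnd, Measure.compProd_add_left, Measure.compProd_add_left] at hρσ
  -- The balance reads `D ⊗ κ + A ⊗ κ + σ = D ⊗ η + B ⊗ η + ρ`. Dropping `A ⊗ κ + σ` exhibits `B ⊗ η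
  -- + ρ` as a majorant of the excess of `D ⊗ κ` over `D ⊗ η`.
  have hDP : D ⊗ₘ P ≤ B ⊗ₘ η + ρ := (hmin D _ inferInstance).1 <| by
    rw [← add_assoc, ← hρσ, add_assoc]
    exact Measure.le_add_right le_rfl
  have hDQ : D ⊗ₘ Q ≤ A ⊗ₘ κ + σ := (hmin D _ inferInstance).2 <| by
    rw [← add_assoc, hρσ, add_assoc]
    exact Measure.le_add_right le_rfl
  have hcA : ∫⁻ q, (w q.1 + v q.2) ∂(A ⊗ₘ κ) ≤ (1 + c) * ∫⁻ p in {p | p.1 ≠ p.2}, w p.1 ∂π := by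
    rw [Measure.lintegral_compProd hW, hA, lintegral_map (by fun_prop) measurable_fst,
      ← lintegral_const_mul _ (by fun_prop)]
    refine lintegral_mono_ae (hκc.mono fun p hp => ?_)
    change ∫⁻ z, (w p.1 + v z) ∂κ p.1 ≤ _
    rw [lintegral_add_left measurable_const, lintegral_const, measure_univ, mul_one, add_mul,
      one_mul]
    gcongr
  have hcB : ∫⁻ q, (w q.1 + v q.2) ∂(B ⊗ₘ η) ≤ (1 + c) * ∫⁻ p in {p | p.1 ≠ p.2}, w p.2 ∂π := by
    rw [Measure.lintegral_compProd hW, hB, lintegral_map (by fun_prop) measurable_snd,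
      ← lintegral_const_mul _ (by fun_prop)]
    refine lintegral_mono_ae (hηc.mono fun p hp => ?_)
    change ∫⁻ z, (w p.2 + v z) ∂η p.2 ≤ _
    rw [lintegral_add_left measurable_const, lintegral_const, measure_univ, mul_one, add_mul,
      one_mul]
    gcongr
  have hcost : offDiagCost w π =
      ∫⁻ p in {p | p.1 ≠ p.2}, w p.1 ∂π + ∫⁻ p in {p | p.1 ≠ p.2}, w p.2 ∂π :=
    lintegral_add_left (by fun_prop) _
  have hdiag : ∫⁻ p in {p | p.1 = p.2}, ∫⁻ q in {q | ¬ (p.1 = p.2 ∧ q.1 = q.2)},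
      (w p.1 + v q.1 + (w p.2 + v q.2)) ∂C p ∂π ≤
      ∫⁻ q, (w q.1 + v q.2) ∂(D ⊗ₘ P) + ∫⁻ q, (w q.1 + v q.2) ∂(D ⊗ₘ Q) := by
    rw [Measure.lintegral_compProd hW, Measure.lintegral_compProd hW,
      ← lintegral_add_left (hWm P), hD]
    refine le_trans ?_ (lintegral_map ((hWm P).add (hWm Q)) measurable_fst).ge
    refine setLIntegral_mono (((hWm P).add (hWm Q)).comp measurable_fst) fun p hp => ?_
    change _ ≤ ∫⁻ z, (w p.1 + v z) ∂P p.1 + ∫⁻ z, (w p.1 + v z) ∂Q p.1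
    obtain ⟨x, y⟩ := p
    obtain rfl : x = y := hp
    simp only [true_and]
    rw [lintegral_add_left (by fun_prop)]
    refine add_le_add ?_ ?_
    · refine le_trans (le_of_eq ?_) (lintegral_mono' (hPC x) le_rfl)
      rw [lintegral_map (by fun_prop) measurable_fst]
    · refine le_trans (le_of_eq ?_) (lintegral_mono' (hQC x) le_rfl)
      rw [lintegral_map (by fun_prop) measurable_snd]
  have hoff : ∫⁻ p in {p | p.1 ≠ p.2}, ∫⁻ q in {q | ¬ (p.1 = p.2 ∧ q.1 = q.2)},
      (w p.1 + v q.1 + (w p.2 + v q.2)) ∂C p ∂π ≤ (1 + c) * offDiagCost w π := by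
    rw [offDiagCost, ← lintegral_const_mul _ (by fun_prop)]
    refine lintegral_mono_ae ?_
    filter_upwards [hκc, hηc] with p h1 h2
    refine (setLIntegral_le_lintegral _ _).trans ?_
    rw [lintegral_add_left (by fun_prop), lintegral_add_left (by fun_prop),
      lintegral_add_left (by fun_prop), lintegral_const, lintegral_const, measure_univ]
    rw [← (hC p).1, Measure.fst, lintegral_map hv measurable_fst] at h1
    rw [← (hC p).2, Measure.snd, lintegral_map hv measurable_snd] at h2
    calc _ ≤ w p.1 * 1 + c * w p.1 + (w p.2 * 1 + c * w p.2) := by gcongr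
      _ = _ := by ring
  have hfub : ∫⁻ r in {r | ¬ (r.1.1 = r.1.2 ∧ r.2.1 = r.2.2)},
        (w r.1.1 + v r.2.1 + (w r.1.2 + v r.2.2)) ∂(π ⊗ₘ C) =
      ∫⁻ p, ∫⁻ q in {q | ¬ (p.1 = p.2 ∧ q.1 = q.2)},
        (w p.1 + v q.1 + (w p.2 + v q.2)) ∂C p ∂π := by
    rw [← lintegral_indicator hbad, Measure.lintegral_compProd (by
      exact Measurable.indicator (by fun_prop) hbad)]
    refine lintegral_congr fun p => ?_
    exact lintegral_indicator (measurable_prodMk_left hbad) _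
  rw [hfub, ← lintegral_add_compl _ hdX]
  calc _ ≤ (∫⁻ q, (w q.1 + v q.2) ∂(B ⊗ₘ η + ρ) + ∫⁻ q, (w q.1 + v q.2) ∂(A ⊗ₘ κ + σ)) +
        (1 + c) * offDiagCost w π :=
        add_le_add (hdiag.trans (add_le_add (lintegral_mono' hDP le_rfl)
          (lintegral_mono' hDQ le_rfl))) hoff
    _ ≤ ((1 + c) * ∫⁻ p in {p | p.1 ≠ p.2}, w p.2 ∂π + ∫⁻ q, (w q.1 + v q.2) ∂ρ +
        ((1 + c) * ∫⁻ p in {p | p.1 ≠ p.2}, w p.1 ∂π + ∫⁻ q, (w q.1 + v q.2) ∂σ)) +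
        (1 + c) * offDiagCost w π := by
        rw [lintegral_add_measure, lintegral_add_measure]
        gcongr
    _ = _ := by rw [hcost]; ring

end Kernels

/-! ### Marginals of a measure composed with a coupling kernel. -/

section Composition

variable {X E : Type*} [MeasurableSpace X] [MeasurableSpace E]

theorem map_fst_compProd_of_coupling {κ η : Kernel X E} [IsMarkovKernel κ]
    {C : Kernel (X × X) (E × E)} [IsMarkovKernel C]
    (hC : ∀ p, IsCoupling (C p) (κ p.1) (η p.2)) (π : Measure (X × X)) [IsFiniteMeasure π] :
    (π ⊗ₘ C).map (fun r => (r.1.1, r.2.1)) = π.fst ⊗ₘ κ := by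
  ext S hS
  rw [Measure.map_apply (by fun_prop) hS, Measure.compProd_apply (by measurability),
    Measure.compProd_apply hS, Measure.fst,
    lintegral_map (Kernel.measurable_kernel_prodMk_left hS) measurable_fst]
  refine lintegral_congr fun p => ?_
  rw [← (hC p).1, Measure.fst_apply (measurable_prodMk_left hS)]
  rfl

theorem map_snd_compProd_of_coupling {κ η : Kernel X E} [IsMarkovKernel η]
    {C : Kernel (X × X) (E × E)} [IsMarkovKernel C]
    (hC : ∀ p, IsCoupling (C p) (κ p.1) (η p.2)) (π : Measure (X × X)) [IsFiniteMeasure π] :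
    (π ⊗ₘ C).map (fun r => (r.1.2, r.2.2)) = π.snd ⊗ₘ η := by
  ext S hS
  rw [Measure.map_apply (by fun_prop) hS, Measure.compProd_apply (by measurability),
    Measure.compProd_apply hS, Measure.snd,
    lintegral_map (Kernel.measurable_kernel_prodMk_left hS) measurable_snd]
  refine lintegral_congr fun p => ?_
  rw [← (hC p).2, Measure.snd_apply (measurable_prodMk_left hS)]
  rfl

end Composition

/-! ### Path spaces, weights and the law of a pair of paths. -/

section Paths

variable {d : ℕ}

theorem measurable_upTo {t T : ℕ} (h : t ≤ T) : Measurable (upTo (d := d) h) :=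
  measurable_pi_lambda _ fun _ => measurable_pi_apply _

theorem measurable_next {t T : ℕ} (h : t < T) : Measurable (next (d := d) h) :=
  measurable_pi_apply _

/-- Append one value to a path. -/
def extend {t : ℕ} (r : PathSpace d t × EuclideanSpace ℝ (Fin d)) : PathSpace d (t + 1) :=
  Fin.snoc (α := fun _ => EuclideanSpace ℝ (Fin d)) r.1 r.2

theorem measurable_extend {t : ℕ} : Measurable (extend (d := d) (t := t)) := by
  refine measurable_pi_lambda _ fun i => ?_
  refine Fin.lastCases ?_ (fun j => ?_) i
  · simpa [extend] using measurable_snd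
  · simp only [extend, Fin.snoc_castSucc]
    exact (measurable_pi_apply j).comp measurable_fst

theorem upTo_extend {s t : ℕ} (h : s ≤ t) (r : PathSpace d t × EuclideanSpace ℝ (Fin d)) :
    upTo (h.trans t.le_succ) (extend r) = upTo h r.1 := by
  ext1 i
  exact Fin.snoc_castSucc (α := fun _ => EuclideanSpace ℝ (Fin d)) r.2 r.1 (Fin.castLE h i)

theorem upTo_self {t : ℕ} (x : PathSpace d t) : upTo le_rfl x = x := rfl

theorem next_extend {t : ℕ} (r : PathSpace d t × EuclideanSpace ℝ (Fin d)) :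
    next t.lt_succ_self (extend r) = r.2 :=
  Fin.snoc_last (α := fun _ => EuclideanSpace ℝ (Fin d)) r.2 r.1

theorem extend_upTo_next {t T : ℕ} (h : t < T) (x : PathSpace d T) :
    extend (upTo h.le x, next h x) = upTo h x := by
  ext1 i
  refine Fin.lastCases ?_ (fun j => ?_) i
  · simp only [extend, Fin.snoc_last]; rfl
  · simp only [extend, Fin.snoc_castSucc]; rfl

theorem extend_inj {t : ℕ} {r r' : PathSpace d t × EuclideanSpace ℝ (Fin d)} :
    extend r = extend r' ↔ r.1 = r'.1 ∧ r.2 = r'.2 := by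
  refine ⟨fun h => ⟨?_, ?_⟩, fun h => by rw [Prod.ext h.1 h.2]⟩
  · simpa only [upTo_extend le_rfl, upTo_self] using congrArg (upTo t.le_succ) h
  · simpa only [next_extend] using congrArg (next t.lt_succ_self) h

theorem pathNorm_extend {t : ℕ} (r : PathSpace d t × EuclideanSpace ℝ (Fin d)) :
    pathNorm (extend r) = pathNorm r.1 + ‖r.2‖ := by
  simp [pathNorm, extend, Fin.sum_univ_castSucc]

theorem pathNorm_nonneg {t : ℕ} (x : PathSpace d t) : 0 ≤ pathNorm x :=
  Finset.sum_nonneg fun _ _ => norm_nonneg _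

theorem measurable_pathNorm {t : ℕ} : Measurable (pathNorm (d := d) (t := t)) :=
  Finset.measurable_sum _ fun i _ => (measurable_pi_apply i).norm

theorem pathNorm_upTo_le {t T : ℕ} (h : t ≤ T) (x : PathSpace d T) :
    pathNorm (upTo h x) ≤ pathNorm x := by
  unfold pathNorm upTo
  refine (Finset.sum_map Finset.univ (Fin.castLEEmb h) fun i => ‖x i‖).symm.trans_le ?_
  exact Finset.sum_le_univ_sum_of_nonneg fun _ => norm_nonneg _

/-- The weight `‖x‖ + 1/2` of the weighted total variation distance. -/
noncomputable def weight {t : ℕ} (x : PathSpace d t) : ℝ≥0∞ := ENNReal.ofReal (pathNorm x + 1 / 2)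

theorem measurable_weight {t : ℕ} : Measurable (weight (d := d) (t := t)) :=
  (measurable_pathNorm.add_const _).ennreal_ofReal

theorem weight_extend {t : ℕ} (r : PathSpace d t × EuclideanSpace ℝ (Fin d)) :
    weight (extend r) = weight r.1 + ENNReal.ofReal ‖r.2‖ := by
  rw [weight, weight, pathNorm_extend,
    ← ENNReal.ofReal_add (by linarith [pathNorm_nonneg r.1]) (norm_nonneg _)]
  congr 1; ring

theorem pathNorm_sub_le_weight {t : ℕ} (x y : PathSpace d t) :
    ENNReal.ofReal (pathNorm (x - y)) ≤ weight x + weight y := by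
  rw [weight, weight, ← ENNReal.ofReal_add (by linarith [pathNorm_nonneg x])
    (by linarith [pathNorm_nonneg y])]
  refine ENNReal.ofReal_le_ofReal ?_
  have : pathNorm (x - y) ≤ pathNorm x + pathNorm y := by
    rw [pathNorm, pathNorm, pathNorm, ← Finset.sum_add_distrib]
    exact Finset.sum_le_sum fun i _ => norm_sub_le _ _
  linarith

/-- Extend both components of a pair of paths. -/
def extendPair {t : ℕ} (r : (PathSpace d t × PathSpace d t) ×
    (EuclideanSpace ℝ (Fin d) × EuclideanSpace ℝ (Fin d))) :
    PathSpace d (t + 1) × PathSpace d (t + 1) :=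
  (extend (r.1.1, r.2.1), extend (r.1.2, r.2.2))

theorem measurable_extendPair {t : ℕ} : Measurable (extendPair (d := d) (t := t)) :=
  (measurable_extend.comp (by fun_prop)).prodMk (measurable_extend.comp (by fun_prop))

/-- The law of the pair of paths with successive conditional laws `C 0, C 1, …`. -/
noncomputable def jointLaw (C : ∀ t, Kernel (PathSpace d t × PathSpace d t)
    (EuclideanSpace ℝ (Fin d) × EuclideanSpace ℝ (Fin d))) :
    ∀ t, Measure (PathSpace d t × PathSpace d t)
  | 0 => Measure.dirac (fun i => i.elim0, fun i => i.elim0)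
  | t + 1 => (jointLaw C t ⊗ₘ C t).map extendPair

theorem offDiagCost_jointLaw_succ (C : ∀ t, Kernel (PathSpace d t × PathSpace d t)
    (EuclideanSpace ℝ (Fin d) × EuclideanSpace ℝ (Fin d))) (t : ℕ) :
    offDiagCost weight (jointLaw C (t + 1)) =
      ∫⁻ r in {r | ¬ (r.1.1 = r.1.2 ∧ r.2.1 = r.2.2)},
        (weight r.1.1 + ENNReal.ofReal ‖r.2.1‖ + (weight r.1.2 + ENNReal.ofReal ‖r.2.2‖))
        ∂(jointLaw C t ⊗ₘ C t) := by
  have hS : MeasurableSet {p : PathSpace d (t + 1) × PathSpace d (t + 1) | p.1 ≠ p.2} :=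
    measurableSet_diagonal.compl
  rw [offDiagCost, jointLaw, setLIntegral_map hS
    (by exact (measurable_weight.comp measurable_fst).add (measurable_weight.comp measurable_snd))
    measurable_extendPair]
  simp only [extendPair, weight_extend, Set.preimage_ofPred_eq, ne_eq, extend_inj]

section JointLaw

variable (C : ∀ t, Kernel (PathSpace d t × PathSpace d t)
    (EuclideanSpace ℝ (Fin d) × EuclideanSpace ℝ (Fin d))) [∀ t, IsMarkovKernel (C t)]

instance isProbabilityMeasure_jointLaw : ∀ t, IsProbabilityMeasure (jointLaw C t)
  | 0 => by rw [jointLaw]; infer_instance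
  | t + 1 => by
    have := isProbabilityMeasure_jointLaw t
    rw [jointLaw]
    exact Measure.isProbabilityMeasure_map measurable_extendPair.aemeasurable

theorem jointLaw_map_upTo {t T : ℕ} (h : t ≤ T) :
    (jointLaw C T).map (fun q => (upTo h q.1, upTo h q.2)) = jointLaw C t := by
  have hm : ∀ {s S : ℕ} (h : s ≤ S),
      Measurable fun q : PathSpace d S × PathSpace d S => (upTo h q.1, upTo h q.2) := fun h =>
    ((measurable_upTo h).comp measurable_fst).prodMk ((measurable_upTo h).comp measurable_snd)
  induction T, h using Nat.le_induction with
  | base => exact Measure.map_id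
  | succ T h ih =>
    rw [jointLaw, Measure.map_map (hm _) measurable_extendPair, ← ih]
    conv_rhs => rw [← Measure.fst_compProd (jointLaw C T) (C T), Measure.fst,
      Measure.map_map (hm _) measurable_fst]
    congr 1
    ext1 r
    exact Prod.ext (upTo_extend h _) (upTo_extend h _)

theorem jointLaw_map_upTo_next {t T : ℕ} (h : t < T) :
    (jointLaw C T).map (fun q => ((upTo h.le q.1, upTo h.le q.2), (next h q.1, next h q.2))) =
      jointLaw C t ⊗ₘ C t := by
  have hm : ∀ {s S : ℕ} (h : s ≤ S),
      Measurable fun q : PathSpace d S × PathSpace d S => (upTo h q.1, upTo h q.2) := fun h =>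
    ((measurable_upTo h).comp measurable_fst).prodMk ((measurable_upTo h).comp measurable_snd)
  have hm' : ∀ {s S : ℕ} (h : s < S),
      Measurable fun q : PathSpace d S × PathSpace d S => (next h q.1, next h q.2) := fun h =>
    ((measurable_next h).comp measurable_fst).prodMk ((measurable_next h).comp measurable_snd)
  -- Consistency of the laws `jointLaw C t` reduces the claim to the horizon `t + 1`, where the last
  -- step is `C t` by construction.
  have h1 := congrArg (Measure.map fun q : PathSpace d (t + 1) × PathSpace d (t + 1) =>
    ((upTo t.le_succ q.1, upTo t.le_succ q.2), (next t.lt_succ_self q.1, next t.lt_succ_self q.2)))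
    (jointLaw_map_upTo C (show t + 1 ≤ T from h))
  rw [Measure.map_map ((hm _).prodMk (hm' _)) (hm _), jointLaw,
    Measure.map_map ((hm _).prodMk (hm' _)) measurable_extendPair] at h1
  refine Eq.trans h1 ?_
  conv_rhs => rw [← Measure.map_id (μ := jointLaw C t ⊗ₘ C t)]
  congr 1
  ext1 r
  exact Prod.ext (Prod.ext (upTo_extend le_rfl _) (upTo_extend le_rfl _))
    (Prod.ext (next_extend _) (next_extend _))

/-- Almost-everywhere uniqueness of disintegration: the kernel used to build the law is a version of
its conditional law. -/
theorem jointStepKernel_jointLaw_ae_eq {t T : ℕ} (h : t < T) :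
    jointStepKernel h (jointLaw C T) =ᵐ[jointLaw C t] C t := by
  have hm' : Measurable fun q : PathSpace d T × PathSpace d T => (next h q.1, next h q.2) :=
    ((measurable_next h).comp measurable_fst).prodMk ((measurable_next h).comp measurable_snd)
  rw [← jointLaw_map_upTo C h.le]
  refine condDistrib_ae_eq_of_measure_eq_compProd _ hm'.aemeasurable ?_
  rw [jointLaw_map_upTo C h.le, jointLaw_map_upTo_next C h]

end JointLaw

/-! ### Marginals and bi-causality of the constructed coupling. -/

theorem map_upTo_next {t T : ℕ} (h : t < T) (μ : Measure (PathSpace d T)) [IsFiniteMeasure μ] :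
    μ.map (fun x => (upTo h.le x, next h x)) = μ.map (upTo h.le) ⊗ₘ stepKernel h μ :=
  (compProd_map_condDistrib (measurable_next h).aemeasurable).symm

theorem map_upTo_succ {t T : ℕ} (h : t < T) (μ : Measure (PathSpace d T)) [IsFiniteMeasure μ] :
    μ.map (upTo h) = (μ.map (upTo h.le) ⊗ₘ stepKernel h μ).map extend := by
  rw [← map_upTo_next, Measure.map_map measurable_extend
    ((measurable_upTo _).prodMk (measurable_next _))]
  congr 1
  ext1 x
  exact (extend_upTo_next h x).symm

/-- Passing to a prefix only lowers the weight, so discrepancies at intermediate times are charged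
to the full-horizon `TV1`. -/
theorem lintegral_weight_map_upTo_next_le {t T : ℕ} (h : t < T) (ρ : Measure (PathSpace d T)) :
    ∫⁻ q, (weight q.1 + ENNReal.ofReal ‖q.2‖) ∂ρ.map (fun x => (upTo h.le x, next h x)) ≤
      ∫⁻ x, weight x ∂ρ := by
  rw [lintegral_map (by exact ((measurable_weight.comp measurable_fst).add
    (measurable_norm.comp measurable_snd).ennreal_ofReal)) ((measurable_upTo _).prodMk (measurable_next _))]
  refine lintegral_mono fun x => ?_
  rw [← weight_extend (upTo h.le x, next h x), extend_upTo_next]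
  refine ENNReal.ofReal_le_ofReal ?_
  linarith [pathNorm_upTo_le h x]

theorem measure_eq_of_subsingleton {Y : Type*} [MeasurableSpace Y] [Subsingleton Y]
    (μ ν : Measure Y) [IsProbabilityMeasure μ] [IsProbabilityMeasure ν] : μ = ν := by
  ext S _
  exact Subsingleton.set_cases (p := fun S => μ S = ν S) (by simp) (by simp) S

variable {T : ℕ} {μ ν : Measure (PathSpace d T)} [IsProbabilityMeasure μ] [IsProbabilityMeasure ν]
  {C : ∀ t, Kernel (PathSpace d t × PathSpace d t)
    (EuclideanSpace ℝ (Fin d) × EuclideanSpace ℝ (Fin d))} [∀ t, IsMarkovKernel (C t)]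

theorem jointLaw_marginals
    (hC : ∀ t (h : t < T) p, IsCoupling (C t p) (stepKernel h μ p.1) (stepKernel h ν p.2)) :
    ∀ t (h : t ≤ T), IsCoupling (jointLaw C t) (μ.map (upTo h)) (ν.map (upTo h)) := by
  intro t
  induction t with
  | zero =>
    intro h
    have := Measure.isProbabilityMeasure_map (μ := μ) (measurable_upTo (d := d) h).aemeasurable
    have := Measure.isProbabilityMeasure_map (μ := ν) (measurable_upTo (d := d) h).aemeasurable
    exact ⟨measure_eq_of_subsingleton _ _, measure_eq_of_subsingleton _ _⟩
  | succ t ih =>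
    intro h
    have hlt : t < T := h
    have : IsMarkovKernel (stepKernel hlt μ) := by unfold stepKernel; infer_instance
    have : IsMarkovKernel (stepKernel hlt ν) := by unfold stepKernel; infer_instance
    obtain ⟨h1, h2⟩ := ih hlt.le
    constructor
    · rw [map_upTo_succ hlt, ← h1, ← map_fst_compProd_of_coupling (hC t hlt), jointLaw,
        Measure.fst, Measure.map_map measurable_fst measurable_extendPair,
        Measure.map_map measurable_extend (by fun_prop)]
      rfl
    · rw [map_upTo_succ hlt, ← h2, ← map_snd_compProd_of_coupling (hC t hlt), jointLaw,
        Measure.snd, Measure.map_map measurable_snd measurable_extendPair,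
        Measure.map_map measurable_extend (by fun_prop)]
      rfl

theorem isBicausalCoupling_jointLaw
    (hC : ∀ t (h : t < T) p, IsCoupling (C t p) (stepKernel h μ p.1) (stepKernel h ν p.2)) :
    IsBicausalCoupling (jointLaw C T) μ ν := by
  refine ⟨?_, fun t _ h => ?_⟩
  · have h := jointLaw_marginals hC T le_rfl
    have hid : upTo (d := d) (le_refl T) = id := rfl
    rwa [hid, Measure.map_id, Measure.map_id] at h
  · rw [jointLaw_map_upTo C h.le]
    filter_upwards [jointStepKernel_jointLaw_ae_eq C h] with p hp
    rw [hp]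
    exact hC t h p

/-! ### The recursion in time and the final bound. -/

theorem add_negPart_eq_add_posPart {Y : Type*} [MeasurableSpace Y] (μ ν : Measure Y)
    [IsFiniteMeasure μ] [IsFiniteMeasure ν] :
    μ + (μ.toSignedMeasure - ν.toSignedMeasure).toJordanDecomposition.negPart =
      ν + (μ.toSignedMeasure - ν.toSignedMeasure).toJordanDecomposition.posPart := by
  set J := (μ.toSignedMeasure - ν.toSignedMeasure).toJordanDecomposition
  have h : J.toSignedMeasure = μ.toSignedMeasure - ν.toSignedMeasure :=
    SignedMeasure.toSignedMeasure_toJordanDecomposition _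
  rw [← Measure.toSignedMeasure_eq_toSignedMeasure_iff, Measure.toSignedMeasure_add,
    Measure.toSignedMeasure_add]
  rw [JordanDecomposition.toSignedMeasure, sub_eq_sub_iff_add_eq_add] at h
  rw [← h, add_comm]

theorem offDiagCost_zero_time (π : Measure (PathSpace d 0 × PathSpace d 0)) :
    offDiagCost weight π = 0 := by
  have : {p : PathSpace d 0 × PathSpace d 0 | p.1 ≠ p.2} = ∅ :=
    Set.eq_empty_of_forall_notMem fun p hp => hp (Subsingleton.elim _ _)
  rw [offDiagCost, this, setLIntegral_empty]

/-- Source of the growth constant `c = 2α`: `‖x‖ + 1 ≤ 2 (‖x‖ + 1/2)`. -/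
theorem moment_le_weight {α : ℝ} (hα : 0 < α) {t : ℕ} (x : PathSpace d t) :
    ENNReal.ofReal (α * (pathNorm x + 1)) ≤ ENNReal.ofReal (2 * α) * weight x := by
  rw [weight, ← ENNReal.ofReal_mul (by positivity)]
  refine ENNReal.ofReal_le_ofReal ?_
  nlinarith [mul_nonneg hα.le (pathNorm_nonneg x)]

theorem offDiagCost_jointLaw_le {α : ℝ} (hα : 0 < α)
    (hμα : HasLinearConditionalMoments α μ) (hνα : HasLinearConditionalMoments α ν)
    (hC : ∀ t (h : t < T) p, IsCoupling (C t p) (stepKernel h μ p.1) (stepKernel h ν p.2))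
    (hopt : ∀ t (h : t < T), IsDiagOptimal (C t) (stepKernel h μ) (stepKernel h ν)) :
    ∀ t ≤ T, offDiagCost weight (jointLaw C t) ≤
      ENNReal.ofReal ((3 + 4 * α) ^ t - 1) * TV1 μ ν := by
  intro t
  induction t with
  | zero => intro _; rw [offDiagCost_zero_time]; exact zero_le
  | succ t ih =>
    intro h
    have hlt : t < T := h
    have : IsMarkovKernel (stepKernel hlt μ) := by unfold stepKernel; infer_instance
    have : IsMarkovKernel (stepKernel hlt ν) := by unfold stepKernel; infer_instance
    set J := (μ.toSignedMeasure - ν.toSignedMeasure).toJordanDecomposition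
    have hm : Measurable fun x : PathSpace d T => (upTo hlt.le x, next hlt x) :=
      (measurable_upTo _).prodMk (measurable_next _)
    obtain ⟨h1, h2⟩ := jointLaw_marginals hC t hlt.le
    -- The discrepancy terms are the images of the Jordan parts of `μ - ν` on full paths. They may
    -- overlap after projection, which is harmless since only domination is needed.
    have hbal : (jointLaw C t).fst ⊗ₘ stepKernel hlt μ +
        J.negPart.map (fun x => (upTo hlt.le x, next hlt x)) =
        (jointLaw C t).snd ⊗ₘ stepKernel hlt ν +
        J.posPart.map (fun x => (upTo hlt.le x, next hlt x)) := by
      rw [h1, h2, ← map_upTo_next, ← map_upTo_next, ← Measure.map_add _ _ hm,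
        ← Measure.map_add _ _ hm, add_negPart_eq_add_posPart]
    have hmom : ∀ᵐ p ∂(jointLaw C t).restrict {p | p.1 ≠ p.2},
        ∫⁻ z, ENNReal.ofReal ‖z‖ ∂stepKernel hlt μ p.1 ≤ ENNReal.ofReal (2 * α) * weight p.1 ∧
        ∫⁻ z, ENNReal.ofReal ‖z‖ ∂stepKernel hlt ν p.2 ≤ ENNReal.ofReal (2 * α) * weight p.2 := by
      -- The conditional moment condition starts at `t = 1`; at `t = 0` the off-diagonal set is
      -- empty.
      rcases Nat.eq_zero_or_pos t with rfl | ht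
      · rw [Set.eq_empty_of_forall_notMem (s := {p : PathSpace d 0 × PathSpace d 0 | p.1 ≠ p.2})
          fun p hp => hp (Subsingleton.elim _ _), Measure.restrict_empty]
        simp
      · refine ae_restrict_of_ae ?_
        have e1 := hμα t ht hlt
        have e2 := hνα t ht hlt
        rw [← h1] at e1
        rw [← h2] at e2
        filter_upwards [ae_of_ae_map measurable_fst.aemeasurable e1,
          ae_of_ae_map measurable_snd.aemeasurable e2] with p hp1 hp2
        exact ⟨hp1.trans (moment_le_weight hα _), hp2.trans (moment_le_weight hα _)⟩
    have hTV : ∫⁻ x, weight x ∂J.posPart + ∫⁻ x, weight x ∂J.negPart = TV1 μ ν := by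
      rw [TV1, SignedMeasure.totalVariation, lintegral_add_measure]; rfl
    have hpow : 1 ≤ (3 + 4 * α) ^ t := one_le_pow₀ (by linarith)
    rw [offDiagCost_jointLaw_succ]
    calc _ ≤ _ := offDiagCost_compProd_le (hC t hlt) (hopt t hlt) _ hbal measurable_weight
          measurable_norm.ennreal_ofReal (hmom.mono fun p hp => hp.1) (hmom.mono fun p hp => hp.2)
      _ ≤ 2 * (1 + ENNReal.ofReal (2 * α)) * (ENNReal.ofReal ((3 + 4 * α) ^ t - 1) * TV1 μ ν) +
          TV1 μ ν := by
          rw [← hTV]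
          exact add_le_add (mul_le_mul_right ((ih hlt.le).trans_eq (by rw [hTV])) _)
            (add_le_add (lintegral_weight_map_upTo_next_le _ _)
              (lintegral_weight_map_upTo_next_le _ _))
      _ = ENNReal.ofReal ((2 + 4 * α) * ((3 + 4 * α) ^ t - 1) + 1) * TV1 μ ν := by
          rw [ENNReal.ofReal_add (mul_nonneg (by linarith) (by linarith)) zero_le_one,
            ENNReal.ofReal_mul (p := 2 + 4 * α) (by linarith),
            show 2 + 4 * α = 2 * (1 + 2 * α) by ring, ENNReal.ofReal_mul (q := 1 + 2 * α) zero_le_two,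
            ENNReal.ofReal_add zero_le_one (by linarith)]
          simp only [ENNReal.ofReal_one, ENNReal.ofReal_ofNat]
          ring
      _ ≤ _ := by
          gcongr
          rw [pow_succ]
          -- With `r = 3 + 4α`, the claim `(r - 1)(r ^ t - 1) + 1 ≤ r ^ (t + 1) - 1` amounts to `r ^
          -- t + r ≥ 3`.
          nlinarith

theorem lintegral_pathNorm_sub_le_offDiagCost {t : ℕ}
    (π : Measure (PathSpace d t × PathSpace d t)) :
    ∫⁻ q, ENNReal.ofReal (pathNorm (q.1 - q.2)) ∂π ≤ offDiagCost weight π := by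
  have hS : MeasurableSet {p : PathSpace d t × PathSpace d t | p.1 ≠ p.2} :=
    measurableSet_diagonal.compl
  rw [offDiagCost, ← lintegral_indicator hS]
  refine lintegral_mono fun q => ?_
  by_cases hq : q.1 = q.2
  · simp [hq, pathNorm]
  · rw [Set.indicator_of_mem (show q ∈ {p | p.1 ≠ p.2} from hq)]
    exact pathNorm_sub_le_weight _ _

theorem AW1_le_TV1 {α : ℝ} (hα : 0 < α)
    (hμα : HasLinearConditionalMoments α μ) (hνα : HasLinearConditionalMoments α ν) :
    AW1 μ ν ≤ ENNReal.ofReal ((3 + 4 * α) ^ T - 1) * TV1 μ ν := by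
  have hex : ∀ t, ∃ C : Kernel (PathSpace d t × PathSpace d t)
      (EuclideanSpace ℝ (Fin d) × EuclideanSpace ℝ (Fin d)), IsMarkovKernel C ∧
      ∀ h : t < T, (∀ p, IsCoupling (C p) (stepKernel h μ p.1) (stepKernel h ν p.2)) ∧
        IsDiagOptimal C (stepKernel h μ) (stepKernel h ν) := by
    intro t
    by_cases h : t < T
    · have : IsMarkovKernel (stepKernel h μ) := by unfold stepKernel; infer_instance
      have : IsMarkovKernel (stepKernel h ν) := by unfold stepKernel; infer_instance
      obtain ⟨C, hC, h1, h2⟩ := exists_coupling_kernel (stepKernel h μ) (stepKernel h ν)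
      exact ⟨C, hC, fun _ => ⟨h1, h2⟩⟩
    · exact ⟨Kernel.const _ (Measure.dirac 0), inferInstance, fun h' => absurd h' h⟩
  choose C hCm hC using hex
  refine (iInf₂_le ⟨jointLaw C T, inferInstance⟩
    (isBicausalCoupling_jointLaw fun t h => (hC t h).1)).trans ?_
  exact (lintegral_pathNorm_sub_le_offDiagCost _).trans
    (offDiagCost_jointLaw_le hα hμα hνα (fun t h => (hC t h).1) (fun t h => (hC t h).2) T le_rfl)

end Paths

end AdaptedTransport

theorem theorem3p5 (d T : ℕ) (hd : 1 ≤ d) (hT : 1 ≤ T) (α : ℝ) (hα : 0 < α)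
    (μ ν : MeasureTheory.Measure (AdaptedTransport.PathSpace d T))
    [MeasureTheory.IsProbabilityMeasure μ] [MeasureTheory.IsProbabilityMeasure ν]
    (hμ : AdaptedTransport.HasFiniteFirstMoment μ) (hν : AdaptedTransport.HasFiniteFirstMoment ν)
    (hμα : AdaptedTransport.HasLinearConditionalMoments α μ)
    (hνα : AdaptedTransport.HasLinearConditionalMoments α ν) :
    AdaptedTransport.AW1 μ ν ≤
      ENNReal.ofReal ((3 + 4 * α) ^ T - 1) * AdaptedTransport.TV1 μ ν :=
  AdaptedTransport.AW1_le_TV1 hα hμα hνα
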